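/- **Theorem 3.1.** Let $X_0$ and $X=(X_1,X_2,\ldots)$ be infinitely many independent indeterminates (over $\mathbb{Q}$), and let $u,v$ be two further indeterminates. Write $(x)_r=x(x+1)\cdots(x+r-1)$ and $\binom{x}{r}=\frac{x(x-1)\cdots(x-r+1)}{r!}$. For a partition $\mu=(\mu_1\ge\cdots\ge\mu_l>0)$ let $|\mu|=\sum_i\mu_i$, let $m_i(\mu)$ be the number of parts of $\mu$ equal to $i$, and put $z_\mu=\prod_{i\ge1} i^{m_i(\mu)}\,m_i(\mu)!$. For integers $m\ge1$, $0\le p\le m$ and $k\ge 1$ define $$\binom{m}{p}_{k}=\frac{m}{k}\sum_{r=0}^{k-1}\binom{p}{r}\binom{m-p}{r}\binom{m-r-1}{k-r-1}\quad(1\le k\le m),\qquad \binom{m}{p}_k=0\quad (k>m).$$ For a partition $\mu$ with $l$ parts and integers $0\le p\le|\mu|$, $k\ge1$ define $$\left\langle{\mu\atop p}\right\rangle_{k}=\sum_{(p_i)}\sum_{(k_i)}\prod_{i=1}^{l}\binom{\mu_i}{p_i}_{k_i},$$ the sum being over all $p=\sum_{i=1}^l p_i$ and $k=\sum_{i=1}^l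 k_i$ with $0\le p_i\le\mu_i$ and $k_i\ge1$ for every $i$. For integers $N\ge1$, $k\ge1$ and $0\le p\le N$ let $$P_{N,p,k}(X)=\sum_{|\mu|=N}\frac{1}{z_\mu}\left\langle{\mu\atop p}\right\rangle_{k}\prod_{i\ge1}X_i^{m_i(\mu)},$$ and for $k=0$ let $P_{N,p,0}(X)=0$, with the only exception $P_{0,0,0}(X)=1$. Then for every integer $n\ge1$ the following identity holds between formal power series in $u,v$ with coefficients in $\mathbb{Q}[X_0,X_1,X_2,\ldots]$: $$\sum_{|\mu|=n}\frac1{z_\mu}\prod_{k\ge1}\left(\sum_{r,s\ge0}u^rv^s\,\frac{(k)_r}{r!}\,\frac{(k)_s}{s!}\,X_{r+s}\right)^{m_k(\mu)} =\sum_{p,q\ge0}u^pv^q\left(\sum_{k=0}^{\min(n,p+q)}\binom{X_0+n-1}{n-k}\,P_{p+q,p,k}(X)\right).$$ -/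

import Mathlib

noncomputable section

namespace PartitionIdentity

/-- The multiplicity `m_i(μ)` of the part `i` in the partition `μ`. -/
def mult {n : ℕ} (μ : n.Partition) (i : ℕ) : ℕ := μ.parts.count i

/-- `z_μ = ∏_{i ≥ 1} i ^ m_i(μ) * m_i(μ)!`. All parts of a partition of `n` lie in `[1, n]`, so the
factors with `i > n` are `1`. -/
def zCoeff {n : ℕ} (μ : n.Partition) : ℚ :=
  ∏ i ∈ Finset.Icc 1 n, ((i : ℚ) ^ mult μ i * ((mult μ i).factorial : ℚ))

/-- The parts `μ_1 ≥ μ_2 ≥ ... ≥ μ_l` of a partition, as a weakly decreasing list. -/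
def rows {n : ℕ} (μ : n.Partition) : List ℕ := μ.parts.sort (· ≥ ·)

/-- The numbers `(n/k) * ∑_{r ≥ 0} C(p, r) C(n-p, r) C(n-r-1, k-r-1)`, meant for `0 ≤ p ≤ n` and
`k ≥ 1`. The terms with `r ≥ k` have a negative lower index `k-r-1` and vanish, so the sum runs over
`r < k`. For `k > n ≥ p`, `n ≥ 1`, the value is `0`. -/
def binom₃ (n p k : ℕ) : ℚ :=
  (n : ℚ) / (k : ℚ) *
    ∑ r ∈ Finset.range k,
      (p.choose r : ℚ) * ((n - p).choose r : ℚ) * ((n - r - 1).choose (k - r - 1) : ℚ)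

/-- The generalized binomial coefficient of a partition `μ` with rows `μ_1, ..., μ_l`:
the sum over all `p = ∑ p_i` with `0 ≤ p_i ≤ μ_i` and all `k = ∑ k_i` with `k_i ≠ 0`
of `∏ i, binom₃ μ_i p_i k_i`. -/
def partBinom {n : ℕ} (μ : n.Partition) (p k : ℕ) : ℚ :=
  ∑ a ∈ (Finset.piAntidiag (Finset.univ : Finset (Fin (rows μ).length)) p).filter
      (fun a => ∀ i, a i ≤ (rows μ).get i),
    ∑ b ∈ (Finset.piAntidiag (Finset.univ : Finset (Fin (rows μ).length)) k).filter
        (fun b => ∀ i, b i ≠ 0),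
      ∏ i, binom₃ ((rows μ).get i) (a i) (b i)

/-- The polynomials in the indeterminates `X_0, X_1, X_2, ...`. -/
abbrev Poly : Type := MvPolynomial ℕ ℚ

/-- The indeterminate `X_i`. -/
abbrev X (i : ℕ) : Poly := MvPolynomial.X i

/-- The polynomial `P_{npk} = ∑_{|μ| = n} partBinom μ p k / z_μ * ∏_{i ≥ 1} X_i ^ m_i(μ)`, meant for
`0 ≤ p ≤ n`; for `k = 0` it is `0` by convention, except that `P_{000} = 1`. -/
def P (n p k : ℕ) : Poly :=
  if k = 0 then (if n = 0 ∧ p = 0 then 1 else 0)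
  else ∑ μ : n.Partition,
    (partBinom μ p k / zCoeff μ) • ∏ i ∈ Finset.Icc 1 n, X i ^ mult μ i

/-- The binomial coefficient `C(x, m) = x (x-1) ... (x-m+1) / m!` of a polynomial `x`. -/
def polyChoose (x : Poly) (m : ℕ) : Poly :=
  ((m.factorial : ℚ)⁻¹) • ∏ i ∈ Finset.range m, (x - (i : Poly))

/-- The ring of formal power series in two variables `u` (index `0`) and `v` (index `1`) over the
polynomials in the `X_i`. -/
abbrev Series : Type := MvPowerSeries (Fin 2) Poly

/-- The formal power series `∑_{p, q ≥ 0} u^p v^q c_{p,q}`. -/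
def series (c : ℕ → ℕ → Poly) : Series := fun d => c (d 0) (d 1)

/-- `S_k = ∑_{r, s ≥ 0} u^r v^s ((k)_r / r!) ((k)_s / s!) X_{r+s}`, where
`(k)_r = k (k+1) ... (k+r-1)` is the raising factorial. -/
def S (k : ℕ) : Series :=
  series fun r s =>
    (((k.ascFactorial r : ℚ) / (r.factorial : ℚ)) * ((k.ascFactorial s : ℚ) / (s.factorial : ℚ))) •
      X (r + s)

end PartitionIdentity

end

/-! Write `cycleSum a n` for the coefficient of t^n in exp(∑_k a_k t^k / k); the left side is
`cycleSum S n`. In ∑_k S_k t^k / k the part free of u and v is -X_0 log(1-t). For m = p+q ≥ 1 the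
coefficient of u^p v^q is (X_m / m) ∑_j `binom₃ m p j` (t/(1-t))^j: this is
`sum_binom₃_mul_geomCoeff`, which rests on Li Shanlan's identity. Exponentiating gives (1-t)^(-X_0)
∑ P_{p+q,p,k} u^p v^q (t/(1-t))^k, and t^k (1-t)^(-X_0-k) has t^n-coefficient C(X_0+n-1, n-k).

The exponentials are replaced by recurrences. Multiplied by p+q, the coefficients of u^p v^q on both
sides satisfy the same recurrence: on the left by the Euler derivation
(`natCast_smul_coeff_cycleSum_S`), on the right by Newton's identity for the P
(`natCast_smul_rightCoeff`). The constant terms agree (`coeff_zero_cycleSum_S`), and induction on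
p+q concludes. -/

noncomputable section

namespace PartitionIdentity

open Finset

/-! ### Cycle index sums: Newton's identity and derivations -/

section CycleIndex

variable {A : Type*} [CommRing A] [Algebra ℚ A]

/-- The sum of `z_μ⁻¹ ∏ a_{μ_i}` over the partitions `μ` of `n`. -/
def cycleSum (a : ℕ → A) (n : ℕ) : A :=
  ∑ μ : n.Partition, (1 / zCoeff μ) • (μ.parts.map a).prod

lemma part_mem_Icc {n M : ℕ} (μ : n.Partition) (h : n ≤ M) {i : ℕ} (hi : i ∈ μ.parts) :
    i ∈ Icc 1 M :=
  mem_Icc.2 ⟨μ.parts_pos hi, (Nat.Partition.le_of_mem_parts hi).trans h⟩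

lemma zCoeff_eq_prod_Icc {n M : ℕ} (μ : n.Partition) (h : n ≤ M) :
    zCoeff μ = ∏ i ∈ Icc 1 M, ((i : ℚ) ^ mult μ i * ((mult μ i).factorial : ℚ)) := by
  refine prod_subset (Icc_subset_Icc_right h) fun i _ hi => ?_
  have : mult μ i = 0 := by
    rw [mult, Multiset.count_eq_zero]
    exact fun hm => hi (part_mem_Icc μ le_rfl hm)
  simp [this]

lemma zCoeff_ne_zero {n : ℕ} (μ : n.Partition) : zCoeff μ ≠ 0 := by
  refine prod_ne_zero_iff.2 fun i hi => ?_
  have := (mem_Icc.1 hi).1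
  positivity

lemma prod_map_parts {B : Type*} [CommMonoid B] {n : ℕ} (μ : n.Partition) (a : ℕ → B) :
    (μ.parts.map a).prod = ∏ k ∈ Icc 1 n, a k ^ mult μ k := by
  rw [prod_multiset_map_count]
  refine prod_subset (fun i hi => part_mem_Icc μ le_rfl (Multiset.mem_toFinset.1 hi)) ?_
  intro i _ hi
  rw [Multiset.mem_toFinset] at hi
  rw [Multiset.count_eq_zero.2 hi, pow_zero]

lemma sum_map_parts {B : Type*} [AddCommMonoid B] {n : ℕ} (μ : n.Partition) (a : ℕ → B) :
    (μ.parts.map a).sum = ∑ k ∈ Icc 1 n, mult μ k • a k :=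
  prod_map_parts (B := Multiplicative B) μ a

/-- The partition obtained by adding a part. -/
def consPart {m : ℕ} (k : ℕ) (hk : 1 ≤ k) (ν : m.Partition) : (m + k).Partition where
  parts := k ::ₘ ν.parts
  parts_pos := by
    intro i hi
    rcases Multiset.mem_cons.1 hi with rfl | h
    · exact hk
    · exact ν.parts_pos h
  parts_sum := by rw [Multiset.sum_cons, ν.parts_sum, add_comm]

lemma zCoeff_consPart {m : ℕ} (k : ℕ) (hk : 1 ≤ k) (ν : m.Partition) :
    zCoeff (consPart k hk ν) = k * mult (consPart k hk ν) k * zCoeff ν := by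
  have hmem : k ∈ Icc 1 (m + k) := mem_Icc.2 ⟨hk, by omega⟩
  rw [zCoeff_eq_prod_Icc ν (Nat.le_add_right m k), zCoeff, ← mul_prod_erase _ _ hmem,
    ← mul_prod_erase (Icc 1 (m + k)) _ hmem]
  have h1 : mult (consPart k hk ν) k = mult ν k + 1 := by simp [mult, consPart]
  have h2 : ∀ i ∈ (Icc 1 (m + k)).erase k, mult (consPart k hk ν) i = mult ν i := by
    intro i hi
    simp [mult, consPart, Multiset.count_cons_of_ne (ne_of_mem_erase hi)]
  rw [prod_congr rfl fun i hi => by rw [h2 i hi], h1, Nat.factorial_succ, pow_succ]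
  push_cast
  ring

/-- Removing a part `k` is a bijection onto the partitions of `m`, up to the multiplicity of `k`. -/
lemma sum_erase_part (m k : ℕ) (hk : 1 ≤ k) (φ : Multiset ℕ → A) :
    ∑ μ : (m + k).Partition, ((k * mult μ k : ℚ) / zCoeff μ) • φ (μ.parts.erase k) =
      ∑ ν : m.Partition, (1 / zCoeff ν) • φ ν.parts := by
  symm
  refine sum_of_injOn (consPart k hk) ?_ (fun _ _ => mem_coe.2 (mem_univ _)) ?_ ?_
  · intro ν _ ν' _ h
    have := congrArg Nat.Partition.parts h
    simpa [consPart, Nat.Partition.ext_iff] using this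
  · intro μ _ hμ
    have : mult μ k = 0 := by
      rw [mult, Multiset.count_eq_zero]
      intro hmem
      refine hμ ⟨⟨μ.parts.erase k, fun hi => μ.parts_pos (Multiset.mem_of_mem_erase hi), ?_⟩,
        by simp, ?_⟩
      · have := congrArg Multiset.sum (Multiset.cons_erase hmem)
        rw [Multiset.sum_cons, μ.parts_sum] at this
        omega
      · ext1
        exact Multiset.cons_erase hmem
    simp [this]
  · intro ν _
    have h0 : (k : ℚ) ≠ 0 := by positivity
    have h1 : (mult (consPart k hk ν) k : ℚ) ≠ 0 := by
      simp [mult, consPart]; positivity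
    congr 1
    · rw [zCoeff_consPart]
      have := zCoeff_ne_zero ν
      field_simp
    · simp [consPart]

lemma sum_erase_part' {n k : ℕ} (hk : k ∈ Icc 1 n) (φ : Multiset ℕ → A) :
    ∑ μ : n.Partition, ((k * mult μ k : ℚ) / zCoeff μ) • φ (μ.parts.erase k) =
      ∑ ν : (n - k).Partition, (1 / zCoeff ν) • φ ν.parts := by
  obtain ⟨h1, h2⟩ := mem_Icc.1 hk
  obtain ⟨m, rfl⟩ := Nat.exists_eq_add_of_le' h2
  rw [Nat.add_sub_cancel]
  exact sum_erase_part m k h1 φ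

lemma mult_smul_mul_erase {n : ℕ} (μ : n.Partition) (k : ℕ) (a : ℕ → A) :
    (mult μ k : ℚ) • (a k * ((μ.parts.erase k).map a).prod) =
      (mult μ k : ℚ) • (μ.parts.map a).prod := by
  by_cases h : k ∈ μ.parts
  · rw [← Multiset.prod_cons, ← Multiset.map_cons, Multiset.cons_erase h]
  · simp [mult, Multiset.count_eq_zero.2 h]

/-- Newton's identity n h_n = ∑ p_k h_{n-k}: write n = ∑ k m_k(μ) and remove a part k from each μ.
-/
lemma natCast_smul_cycleSum (a : ℕ → A) (n : ℕ) :
    (n : ℚ) • cycleSum a n = ∑ k ∈ Icc 1 n, a k * cycleSum a (n - k) := by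
  have key : ∀ k ∈ Icc 1 n, a k * cycleSum a (n - k) =
      ∑ μ : n.Partition, ((k * mult μ k : ℚ) / zCoeff μ) • (μ.parts.map a).prod := by
    intro k hk
    rw [cycleSum, mul_sum]
    simp_rw [mul_smul_comm]
    rw [← sum_erase_part' hk (fun s => a k * (s.map a).prod)]
    refine sum_congr rfl fun μ _ => ?_
    rw [mul_div_right_comm, mul_smul, mult_smul_mul_erase, ← mul_smul]
  rw [sum_congr rfl key, sum_comm, cycleSum, smul_sum]
  refine sum_congr rfl fun μ _ => ?_
  rw [← sum_smul, ← sum_div, ← mul_smul]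
  congr 1
  have := sum_map_parts μ (fun k => (k : ℚ))
  rw [← Nat.cast_multiset_sum, μ.parts_sum] at this
  rw [this, mul_one_div]
  simp [mul_comm]

lemma derivation_multiset_prod (D : Derivation ℚ A A) (a : ℕ → A) (s : Multiset ℕ) :
    D (s.map a).prod = (s.map fun k => ((s.erase k).map a).prod * D (a k)).sum := by
  induction s using Multiset.induction_on with
  | empty => simp
  | cons k s ih =>
    rw [Multiset.map_cons, Multiset.prod_cons, D.leibniz, ih, Multiset.map_cons,
      Multiset.sum_cons, Multiset.erase_cons_head, smul_eq_mul, smul_eq_mul, add_comm,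
      ← Multiset.sum_map_mul_left]
    congr 2
    refine Multiset.map_congr rfl fun j hj => ?_
    rw [← mul_assoc]
    congr 1
    by_cases h : j = k
    · subst h
      rw [Multiset.erase_cons_head, ← Multiset.prod_cons, ← Multiset.map_cons,
        Multiset.cons_erase hj]
    · rw [Multiset.erase_cons_tail _ (Ne.symm h), Multiset.map_cons, Multiset.prod_cons]

/-- The t^n-coefficient of D(exp F) = D(F) exp F, where F = ∑ a_k t^k / k. By Leibniz, D strikes out
one part at a time, and removing k absorbs k m_k(μ), whence the factor 1/k. -/
lemma derivation_cycleSum (D : Derivation ℚ A A) (a : ℕ → A) (n : ℕ) :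
    D (cycleSum a n) =
      ∑ k ∈ Icc 1 n, (1 / k : ℚ) • (D (a k) * cycleSum a (n - k)) := by
  have key : ∀ k ∈ Icc 1 n, (1 / k : ℚ) • (D (a k) * cycleSum a (n - k)) =
      ∑ μ : n.Partition,
        (1 / zCoeff μ) • mult μ k • (((μ.parts.erase k).map a).prod * D (a k)) := by
    intro k hk
    have hk0 : (k : ℚ) ≠ 0 := by
      have := (mem_Icc.1 hk).1
      positivity
    rw [cycleSum, mul_sum]
    simp_rw [mul_smul_comm]
    rw [← sum_erase_part' hk (fun s => D (a k) * (s.map a).prod), smul_sum]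
    refine sum_congr rfl fun μ _ => ?_
    rw [← Nat.cast_smul_eq_nsmul ℚ, ← mul_smul, ← mul_smul, mul_comm (D _)]
    congr 1
    field_simp
  rw [sum_congr rfl key, sum_comm, cycleSum, map_sum]
  refine sum_congr rfl fun μ _ => ?_
  rw [Derivation.map_smul, derivation_multiset_prod, sum_map_parts, smul_sum]

lemma map_cycleSum {B : Type*} [CommRing B] [Algebra ℚ B] (f : A →ₐ[ℚ] B) (a : ℕ → A) (n : ℕ) :
    f (cycleSum a n) = cycleSum (fun k => f (a k)) n := by
  simp [cycleSum, map_sum, map_multiset_prod, Multiset.map_map]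

lemma cycleSum_zero (a : ℕ → A) : cycleSum a 0 = 1 := by
  simp [cycleSum, zCoeff, Nat.Partition.partition_zero_parts]

end CycleIndex


/-! ### Binomial sums and Li Shanlan's identity -/

section Binomials

lemma sum_choose_mul_choose (p j : ℕ) :
    ∑ r ∈ range (j + 1), p.choose r * j.choose r = (p + j).choose j := by
  rw [Nat.add_choose_eq, Nat.sum_antidiagonal_eq_sum_range_succ_mk]
  refine sum_congr rfl fun r hr => ?_
  rw [Nat.choose_symm (by simpa [Nat.lt_succ_iff] using hr)]

lemma sum_choose_mul_choose_of_le (p : ℕ) {j q : ℕ} (h : j ≤ q) :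
    ∑ r ∈ range (q + 1), p.choose r * j.choose r = (p + j).choose j := by
  rw [← sum_choose_mul_choose]
  symm
  refine sum_subset (range_subset_range.2 (by omega)) fun r _ hr => ?_
  rw [Nat.choose_eq_zero_of_lt (n := j) (by simp at hr; omega), mul_zero]

/-- Li Shanlan's identity. -/
lemma sum_choose_mul_choose_mul_choose (x p q : ℕ) :
    ∑ r ∈ range (q + 1), p.choose r * q.choose r * (x + p + (q - r)).choose (p + q) =
      (x + p).choose p * (x + q).choose q := by
  have h1 : ∀ r ∈ range (q + 1), p.choose r * q.choose r * (x + p + (q - r)).choose (p + q) =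
      ∑ j ∈ range (q + 1),
        (x + p).choose (p + j) * (q.choose j * (p.choose r * j.choose r)) := by
    intro r hr
    have hr' : r ≤ q := by simpa [Nat.lt_succ_iff] using hr
    -- Vandermonde; indices below p contribute nothing, as their complementary lower index exceeds q
    -- ≥ q - r.
    have h2 : (x + p + (q - r)).choose (p + q) =
        ∑ j ∈ range (q + 1), (x + p).choose (p + j) * (q - r).choose (q - j) := by
      rw [Nat.add_choose_eq, Nat.sum_antidiagonal_eq_sum_range_succ_mk,
        show (p + q).succ = p + (q + 1) from rfl, sum_range_add]
      rw [sum_eq_zero, zero_add]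
      · exact sum_congr rfl fun j _ => by rw [Nat.add_sub_add_left]
      · intro i hi
        rw [mem_range] at hi
        dsimp only
        rw [Nat.choose_eq_zero_of_lt (n := q - r) (by omega), mul_zero]
    rw [h2, mul_sum]
    refine sum_congr rfl fun j hj => ?_
    have hj' : j ≤ q := by simpa [Nat.lt_succ_iff] using hj
    have h3 : q.choose r * (q - r).choose (q - j) = q.choose j * j.choose r := by
      by_cases h : r ≤ j
      · rw [Nat.choose_mul h, show q - j = (q - r) - (j - r) by omega,
          Nat.choose_symm (by omega)]
      · rw [Nat.choose_eq_zero_of_lt (n := q - r) (by omega),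
          Nat.choose_eq_zero_of_lt (n := j) (by omega), mul_zero, mul_zero]
    calc _ = p.choose r * (x + p).choose (p + j) * (q.choose r * (q - r).choose (q - j)) := by ring
      _ = _ := by rw [h3]; ring
  rw [sum_congr rfl h1, sum_comm]
  have h4 : ∀ j ∈ range (q + 1), ∑ r ∈ range (q + 1),
      (x + p).choose (p + j) * (q.choose j * (p.choose r * j.choose r)) =
        (x + p).choose p * (x.choose j * q.choose (q - j)) := by
    intro j hj
    have hj' : j ≤ q := by simpa [Nat.lt_succ_iff] using hj
    rw [← mul_sum, ← mul_sum, sum_choose_mul_choose_of_le p hj', Nat.choose_symm hj']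
    have h5 : (x + p).choose (p + j) * (p + j).choose j = (x + p).choose p * x.choose j := by
      by_cases h : j ≤ x
      · have := Nat.choose_mul (n := x + p) (k := p + j) (s := p) (by omega)
        rw [Nat.add_sub_cancel, Nat.add_sub_cancel_left] at this
        rw [← this, Nat.choose_symm_add]
      · rw [Nat.choose_eq_zero_of_lt (n := x + p) (by omega),
          Nat.choose_eq_zero_of_lt (n := x) (by omega), zero_mul, mul_zero]
    calc _ = q.choose j * ((x + p).choose (p + j) * (p + j).choose j) := by ring
      _ = _ := by rw [h5]; ring
  rw [sum_congr rfl h4, ← mul_sum, Nat.add_choose_eq x q q,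
    Nat.sum_antidiagonal_eq_sum_range_succ_mk]

/-- Vandermonde, in the form `∑_k C(n, k) C(a, k - r - 1) = C(n + a, n - r - 1)`. -/
lemma sum_choose_mul_choose_sub (n a r : ℕ) (hr : r < n) :
    ∑ k ∈ Ico (r + 1) (n + 1), n.choose k * a.choose (k - r - 1) =
      (n + a).choose (n - r - 1) := by
  rw [add_comm n a, Nat.add_choose_eq, Nat.sum_antidiagonal_eq_sum_range_succ_mk,
    sum_Ico_eq_sum_range, show n + 1 - (r + 1) = (n - r - 1).succ by omega]
  refine sum_congr rfl fun i hi => ?_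
  rw [mem_range] at hi
  dsimp only
  rw [show r + 1 + i - r - 1 = i by omega, mul_comm,
    ← Nat.choose_symm (n := n) (k := r + 1 + i) (by omega),
    show n - (r + 1 + i) = n - r - 1 - i by omega]

/-- The coefficient of `t ^ n` in `(t / (1 - t)) ^ j`. -/
def geomCoeff (j n : ℕ) : ℚ :=
  if j = 0 then (if n = 0 then 1 else 0) else if n = 0 then 0 else ((n - 1).choose (j - 1) : ℚ)

lemma geomCoeff_succ_zero (j : ℕ) : geomCoeff (j + 1) 0 = 0 := by
  simp [geomCoeff]

lemma geomCoeff_succ_succ (j n : ℕ) : geomCoeff (j + 1) (n + 1) = n.choose j := by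
  simp [geomCoeff]

lemma geomCoeff_pascal (j n : ℕ) :
    geomCoeff (j + 1) (n + 1) = geomCoeff (j + 1) n + geomCoeff j n := by
  rw [geomCoeff_succ_succ]
  cases n with
  | zero => cases j <;> simp [geomCoeff]
  | succ n =>
    cases j with
    | zero => simp [geomCoeff]
    | succ j =>
      rw [geomCoeff_succ_succ, geomCoeff_succ_succ, Nat.choose_succ_succ]
      push_cast
      ring

/-- The coefficient of `t ^ n` in the identity
`∑ t ^ k / k C(k+p-1, p) C(k+q-1, q) = 1 / (p + q) ∑ binom₃ (p + q) p k (t / (1 - t)) ^ k`. -/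
lemma sum_binom₃_mul_geomCoeff (n p q : ℕ) (hn : 1 ≤ n) (hpq : 1 ≤ p + q) :
    ∑ k ∈ range (n + 1), binom₃ (p + q) p k * geomCoeff k n =
      ((p + q : ℕ) : ℚ) / n *
        (((n + p - 1).choose p : ℚ) * ((n + q - 1).choose q : ℚ)) := by
  have hn0 : (n : ℚ) ≠ 0 := by positivity
  obtain ⟨x, rfl⟩ : ∃ x, n = x + 1 := ⟨n - 1, by omega⟩
  have h1 : ∀ k ∈ range (x + 1 + 1), binom₃ (p + q) p k * geomCoeff k (x + 1) =
      ((p + q : ℕ) : ℚ) / (x + 1 : ℕ) * ∑ r ∈ range k, (((x + 1).choose k *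
        (p.choose r * q.choose r * (p + q - r - 1).choose (k - r - 1)) : ℕ) : ℚ) := by
    intro k _
    cases k with
    | zero => simp [geomCoeff]
    | succ k =>
      have hk : ((k : ℚ) + 1) ≠ 0 := by positivity
      have h := Nat.add_one_mul_choose_eq x k
      -- Absorption: trades the factor 1/k of `binom₃` for 1/n, turning C(n-1, k-1) into C(n, k).
      have h' : ((x : ℚ) + 1) * x.choose k = (x + 1).choose (k + 1) * (k + 1) := by
        exact_mod_cast h
      rw [geomCoeff_succ_succ, binom₃]
      simp only [Nat.cast_mul]
      rw [← mul_sum, Nat.add_sub_cancel_left]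
      push_cast at hn0 ⊢
      field_simp
      linear_combination (((p : ℚ) + q) * ∑ r ∈ range (k + 1), (p.choose r : ℚ) * (q.choose r : ℚ) *
        ((p + q - r - 1).choose (k + 1 - r - 1) : ℚ)) * h'
  rw [sum_congr rfl h1, ← mul_sum]
  congr 1
  have h2 : ∀ k ∈ range (x + 1 + 1), ∑ r ∈ range k, (((x + 1).choose k *
        (p.choose r * q.choose r * (p + q - r - 1).choose (k - r - 1)) : ℕ) : ℚ) =
      ∑ r ∈ range (x + 1), if r < k then (((x + 1).choose k *
        (p.choose r * q.choose r * (p + q - r - 1).choose (k - r - 1)) : ℕ) : ℚ) else 0 := by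
    intro k hk
    rw [← sum_filter]
    refine sum_congr ?_ fun _ _ => rfl
    ext r
    simp at hk ⊢
    omega
  rw [sum_congr rfl h2, sum_comm]
  have h3 : ∀ r ∈ range (x + 1), (∑ k ∈ range (x + 1 + 1), if r < k then (((x + 1).choose k *
        (p.choose r * q.choose r * (p + q - r - 1).choose (k - r - 1)) : ℕ) : ℚ) else 0) =
      ((p.choose r * q.choose r * (x + p + (q - r)).choose (p + q) : ℕ) : ℚ) := by
    intro r hr
    rw [mem_range] at hr
    rw [← sum_filter, show (range (x + 1 + 1)).filter (r < ·) = Ico (r + 1) (x + 1 + 1) by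
      ext; simp; omega, ← Nat.cast_sum]
    congr 1
    -- For r ≤ min p q no subtraction p+q-r-1 or q-r truncates, since p+q ≥ 1; otherwise the product
    -- of binomials is zero.
    by_cases hq : r ≤ q ∧ r ≤ p
    · calc _ = p.choose r * q.choose r * ∑ k ∈ Ico (r + 1) (x + 1 + 1),
            (x + 1).choose k * (p + q - r - 1).choose (k - r - 1) := by
            rw [mul_sum]
            exact sum_congr rfl fun k _ => by ring
        _ = _ := by
            rw [sum_choose_mul_choose_sub _ _ _ hr]
            congr 1
            rw [show x + 1 + (p + q - r - 1) = x + p + (q - r) by omega,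
              ← Nat.choose_symm (n := x + p + (q - r)) (k := x + 1 - r - 1) (by omega)]
            congr 1
            omega
    · have : p.choose r * q.choose r = 0 := by
        by_cases hr' : r ≤ q
        · rw [Nat.choose_eq_zero_of_lt (n := p) (by omega), zero_mul]
        · rw [Nat.choose_eq_zero_of_lt (n := q) (by omega), mul_zero]
      simp [this]
  rw [sum_congr rfl h3, ← Nat.cast_sum, ← Nat.cast_mul]
  congr 1
  rw [show x + 1 + p - 1 = x + p by omega, show x + 1 + q - 1 = x + q by omega,
    ← sum_choose_mul_choose_mul_choose]
  -- The two sums stop at different bounds, n - 1 and q; the summand vanishes beyond either, so both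
  -- extend to a common range.
  have h4 : ∀ r, x < r ∨ q < r →
      p.choose r * q.choose r * (x + p + (q - r)).choose (p + q) = 0 := by
    intro r hr
    by_cases h : q < r
    · rw [Nat.choose_eq_zero_of_lt h, mul_zero, zero_mul]
    · rw [Nat.choose_eq_zero_of_lt (n := x + p + (q - r)) (by omega), mul_zero]
  rw [sum_subset (range_subset_range.2 (le_max_left (x + 1) (q + 1))),
    sum_subset (range_subset_range.2 (le_max_right (x + 1) (q + 1)))]
  · exact fun r _ h => h4 r (by simp at h; omega)
  · exact fun r _ h => h4 r (by simp at h; omega)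

end Binomials


/-! ### The polynomials P as coefficients of a cycle index sum -/

section GeneratingSeries

/-- The double generating series of the numbers `binom₃ m p k` with `p ≤ m` and `k ≠ 0`,
multiplied by the indeterminate `X m`. -/
def binomSeries (m : ℕ) : PowerSeries (PowerSeries Poly) :=
  PowerSeries.mk fun p => PowerSeries.mk fun k =>
    if p ≤ m ∧ k ≠ 0 then binom₃ m p k • X m else 0

lemma map_finsuppAntidiag_univ {ι : Type*} [Fintype ι] [DecidableEq ι] {B : Type*}
    [AddCommMonoid B] (n : ℕ) (f : (ι → ℕ) → B) :
    ∑ l ∈ finsuppAntidiag (univ : Finset ι) n, f l = ∑ l ∈ piAntidiag (univ : Finset ι) n, f l := by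
  refine sum_nbij' (fun l => l) (fun l => Finsupp.equivFunOnFinite.symm l) ?_ ?_ ?_ ?_ ?_ <;>
    simp

/-- Expanding the product distributes p, then k, over the rows; the cutoffs in `binomSeries` become
the two filters of `partBinom`. -/
lemma coeff_coeff_prod_binomSeries {n : ℕ} (μ : n.Partition) (p k : ℕ) :
    PowerSeries.coeff k (PowerSeries.coeff p (μ.parts.map binomSeries).prod) =
      partBinom μ p k • (μ.parts.map X).prod := by
  have h1 : ∀ {B : Type} [CommMonoid B] (f : ℕ → B),
      (μ.parts.map f).prod = ∏ i, f ((rows μ).get i) := by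
    intro B _ f
    have h : μ.parts = (rows μ : Multiset ℕ) := (Multiset.sort_eq _ _).symm
    rw [h, Multiset.map_coe, Multiset.prod_coe]
    simp
  rw [h1, h1, PowerSeries.coeff_prod, map_finsuppAntidiag_univ p (fun l =>
    ∏ i, PowerSeries.coeff (l i) (binomSeries ((rows μ).get i))), map_sum, partBinom, sum_smul,
    sum_filter]
  refine sum_congr rfl fun a _ => ?_
  rw [PowerSeries.coeff_prod, map_finsuppAntidiag_univ k (fun l =>
    ∏ i, PowerSeries.coeff (l i) (PowerSeries.coeff (a i) (binomSeries ((rows μ).get i))))]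
  simp only [binomSeries, PowerSeries.coeff_mk]
  simp_rw [prod_ite_zero, forall_and]
  split_ifs with ha
  · rw [sum_filter, sum_smul]
    refine sum_congr rfl fun b _ => ?_
    by_cases hb : ∀ i ∈ univ, b i ≠ 0
    · rw [if_pos, if_pos (by simpa using hb)]
      · simp_rw [← MvPolynomial.C_mul', prod_mul_distrib, ← map_prod]
      · exact ⟨fun i _ => ha i, hb⟩
    · rw [if_neg, if_neg (by simpa using hb), zero_smul]
      exact fun h => hb h.2
  · exact sum_eq_zero fun b _ => if_neg fun h => ha fun i => h.1 i (mem_univ _)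

lemma partBinom_zero_right {n : ℕ} (hn : n ≠ 0) (μ : n.Partition) (p : ℕ) :
    partBinom μ p 0 = 0 := by
  refine sum_eq_zero fun a _ => ?_
  rw [filter_eq_empty_iff.2, sum_empty]
  intro b hb h
  have hlen : 0 < (rows μ).length := by
    rw [rows, Multiset.length_sort, Multiset.card_pos]
    intro h0
    have := μ.parts_sum
    simp [h0] at this
    exact hn this.symm
  have : ∑ i, b i = 0 := (mem_piAntidiag.1 hb).1
  exact h ⟨0, hlen⟩ (sum_eq_zero_iff.1 this _ (mem_univ _))

/-- Makes Newton's identity available for P. The convention at k = 0 is what the series gives: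
nonzero k_i cannot sum to 0 unless there are no rows. -/
lemma coeff_coeff_cycleSum_binomSeries (n p k : ℕ) :
    PowerSeries.coeff k (PowerSeries.coeff p (cycleSum binomSeries n)) = P n p k := by
  rcases eq_or_ne n 0 with rfl | hn
  · rw [cycleSum_zero, PowerSeries.coeff_one]
    rcases eq_or_ne k 0 with rfl | hk
    · by_cases hp : p = 0 <;> simp [P, hp]
    · rw [P, if_neg hk, sum_eq_zero]
      · split_ifs <;> simp [PowerSeries.coeff_one, hk]
      · intro μ _
        have h : rows μ = [] := by simp [rows, Nat.Partition.partition_zero_parts]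
        have : partBinom μ p k = 0 := by
          refine sum_eq_zero fun a _ => ?_
          rw [filter_eq_empty_iff.2, sum_empty]
          intro b hb _
          have : ∑ i, b i = k := (mem_piAntidiag.1 hb).1
          have hl : IsEmpty (Fin (rows μ).length) := by rw [h]; exact Fin.isEmpty
          rw [sum_of_isEmpty] at this
          exact hk this.symm
        rw [this, zero_div, zero_smul]
  · have h1 : PowerSeries.coeff k (PowerSeries.coeff p (cycleSum binomSeries n)) =
        ∑ μ : n.Partition,
          (partBinom μ p k / zCoeff μ) • ∏ i ∈ Icc 1 n, X i ^ mult μ i := by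
      rw [cycleSum, map_sum, map_sum]
      refine sum_congr rfl fun μ _ => ?_
      rw [← prod_map_parts, ← one_div_mul_eq_div (zCoeff μ) (partBinom μ p k),
        mul_smul (1 / zCoeff μ) (partBinom μ p k),
        ← coeff_coeff_prod_binomSeries]
      rfl
    rw [h1, P]
    rcases eq_or_ne k 0 with rfl | hk
    · rw [if_pos rfl, if_neg fun h => hn h.1]
      exact sum_eq_zero fun μ _ => by rw [partBinom_zero_right hn, zero_div, zero_smul]
    · rw [if_neg hk]

lemma natCast_smul_P (n p k : ℕ) :
    (n : ℚ) • P n p k = ∑ m ∈ Icc 1 n, ∑ x ∈ antidiagonal p, ∑ y ∈ antidiagonal k,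
      (if x.1 ≤ m ∧ y.1 ≠ 0 then binom₃ m x.1 y.1 • X m else 0) * P (n - m) x.2 y.2 := by
  have h := congrArg (fun f => PowerSeries.coeff k (PowerSeries.coeff p f))
    (natCast_smul_cycleSum binomSeries n)
  rw [show PowerSeries.coeff k (PowerSeries.coeff p ((n : ℚ) • cycleSum binomSeries n)) =
    (n : ℚ) • PowerSeries.coeff k (PowerSeries.coeff p (cycleSum binomSeries n)) from rfl,
    coeff_coeff_cycleSum_binomSeries] at h
  rw [h, map_sum, map_sum]
  refine sum_congr rfl fun m _ => ?_
  rw [PowerSeries.coeff_mul, map_sum]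
  refine sum_congr rfl fun x _ => ?_
  rw [PowerSeries.coeff_mul]
  refine sum_congr rfl fun y _ => ?_
  rw [coeff_coeff_cycleSum_binomSeries]
  simp [binomSeries]

lemma P_eq_zero_of_lt (n p k : ℕ) (h : n < p) : P n p k = 0 := by
  induction n using Nat.strong_induction_on generalizing p k with
  | _ n ih =>
    rcases eq_or_ne n 0 with rfl | hn
    · rw [← coeff_coeff_cycleSum_binomSeries, cycleSum_zero, PowerSeries.coeff_one,
        if_neg h.ne', map_zero]
    · have h0 : (n : ℚ) • P n p k = 0 := by
        rw [natCast_smul_P]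
        refine sum_eq_zero fun m hm => sum_eq_zero fun x hx => sum_eq_zero fun y _ => ?_
        rw [mem_Icc] at hm
        rw [HasAntidiagonal.mem_antidiagonal] at hx
        by_cases hxm : x.1 ≤ m
        · rw [ih (n - m) (by omega) _ _ (by omega), mul_zero]
        · rw [if_neg (fun h => hxm h.1), zero_mul]
      exact (smul_eq_zero.1 h0).resolve_left (by exact_mod_cast hn)

/-- The recurrence for the polynomials `P` by total degree, indexed by the two exponents. -/
lemma natCast_smul_P_add (p q k : ℕ) :
    ((p + q : ℕ) : ℚ) • P (p + q) p k =
      ∑ x ∈ antidiagonal p, ∑ z ∈ antidiagonal q, ∑ y ∈ antidiagonal k,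
        (binom₃ (x.1 + z.1) x.1 y.1 • X (x.1 + z.1)) * P (x.2 + z.2) x.2 y.2 := by
  have hb0 : ∀ m r, binom₃ m r 0 = 0 := by simp [binom₃]
  have hb0' : ∀ r k, binom₃ 0 r k = 0 := by simp [binom₃]
  rw [natCast_smul_P, sum_comm]
  refine sum_congr rfl fun x hx => ?_
  rw [HasAntidiagonal.mem_antidiagonal] at hx
  symm
  have : ∀ z ∈ antidiagonal q, x.1 + z.1 ∉ Icc 1 (p + q) → ∑ y ∈ antidiagonal k,
        (binom₃ (x.1 + z.1) x.1 y.1 • X (x.1 + z.1)) * P (x.2 + z.2) x.2 y.2 = 0 := by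
    intro z hz h
    rw [HasAntidiagonal.mem_antidiagonal] at hz
    rw [mem_Icc] at h
    rw [show x.1 + z.1 = 0 by omega]
    simp [hb0']
  rw [← sum_filter_of_ne (p := fun z => x.1 + z.1 ∈ Icc 1 (p + q))
    fun z hz h => by_contra fun hn => h (this z hz hn)]
  refine sum_of_injOn (fun z => x.1 + z.1) ?_ ?_ ?_ ?_
  · intro z hz z' hz' h
    simp only [coe_filter, HasAntidiagonal.mem_antidiagonal, Set.mem_ofPred_eq] at hz hz' h
    ext <;> omega
  · intro z hz
    exact mem_coe.2 (mem_filter.1 (mem_coe.1 hz)).2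
  · intro m hm hmem
    -- A value m not of the form x.1 + z.1 has x.1 > m or x.2 > p + q - m; the cutoff kills the
    -- former, `P_eq_zero_of_lt` the latter.
    refine sum_eq_zero fun y _ => ?_
    by_cases h1 : x.1 ≤ m
    · by_cases h2 : x.2 ≤ p + q - m
      · refine absurd ⟨(m - x.1, q - (m - x.1)), ?_, ?_⟩ hmem
        · have hm' := mem_Icc.1 hm
          simp only [coe_filter, HasAntidiagonal.mem_antidiagonal, Set.mem_ofPred_eq, mem_Icc]
          omega
        · dsimp only
          omega
      · rw [P_eq_zero_of_lt _ _ _ (by omega), mul_zero]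
    · rw [if_neg (fun h => h1 h.1), zero_mul]
  · intro z hz
    simp only [mem_filter, HasAntidiagonal.mem_antidiagonal, mem_Icc] at hz
    refine sum_congr rfl fun y _ => ?_
    rw [show p + q - (x.1 + z.1) = x.2 + z.2 by omega]
    by_cases hy : y.1 = 0
    · simp [hy, hb0]
    · rw [if_pos ⟨Nat.le_add_right _ _, hy⟩]

end GeneratingSeries


/-! ### Binomial coefficients in X_0 and powers of 1 - t -/

section PolyChoose

lemma polyChoose_zero (x : Poly) : polyChoose x 0 = 1 := by
  simp [polyChoose]

lemma polyChoose_pascal (x : Poly) (m : ℕ) :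
    polyChoose (x + 1) (m + 1) = polyChoose x (m + 1) + polyChoose x m := by
  have h : (((m + 1).factorial : ℚ)⁻¹) * ((m : ℚ) + 1) = (m.factorial : ℚ)⁻¹ := by
    rw [Nat.factorial_succ]
    push_cast
    field_simp
  have hC := congrArg (MvPolynomial.C (σ := ℕ)) h
  rw [map_mul, map_add, map_one, map_natCast] at hC
  simp only [polyChoose, ← MvPolynomial.C_mul']
  rw [prod_range_succ', prod_range_succ, ← hC]
  have : ∏ i ∈ range m, (x + 1 - ((i + 1 : ℕ) : Poly)) = ∏ i ∈ range m, (x - (i : Poly)) :=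
    prod_congr rfl fun i _ => by push_cast; ring
  rw [this]
  push_cast
  ring

lemma succ_smul_polyChoose (n : ℕ) (x : Poly) :
    ((n + 1 : ℕ) : ℚ) • polyChoose (x + ((n + 1 : ℕ) : Poly) - 1) (n + 1) =
      (x + n) * polyChoose (x + (n : Poly) - 1) n := by
  have h : ((n : ℚ) + 1) * (((n + 1).factorial : ℚ)⁻¹) = (n.factorial : ℚ)⁻¹ := by
    rw [Nat.factorial_succ]
    push_cast
    field_simp
  have hC := congrArg (MvPolynomial.C (σ := ℕ)) h
  rw [map_mul, map_add, map_one, map_natCast] at hC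
  simp only [polyChoose, ← MvPolynomial.C_mul']
  rw [prod_range_succ', ← hC]
  have : ∏ i ∈ range n, (x + ((n + 1 : ℕ) : Poly) - 1 - ((i + 1 : ℕ) : Poly)) =
      ∏ i ∈ range n, (x + (n : Poly) - 1 - (i : Poly)) :=
    prod_congr rfl fun i _ => by push_cast; ring
  rw [this]
  push_cast
  simp only [map_add, map_natCast, map_one]
  ring

/-- The coefficient of `t ^ n` in `t ^ k (1 - t) ^ (- X 0 - k)`. -/
def shiftedChoose (n k : ℕ) : Poly :=
  if k ≤ n then polyChoose (X 0 + (n : Poly) - 1) (n - k) else 0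

lemma shiftedChoose_of_lt {n k : ℕ} (h : n < k) : shiftedChoose n k = 0 :=
  if_neg h.not_ge

/-- Multiplying t^(k+1) (1-t)^(-X_0-k-1) by 1 - t gives t times t^k (1-t)^(-X_0-k). -/
lemma shiftedChoose_pascal (n k : ℕ) :
    shiftedChoose (n + 1) (k + 1) = shiftedChoose n (k + 1) + shiftedChoose n k := by
  rcases lt_trichotomy k n with h | rfl | h
  · rw [shiftedChoose, shiftedChoose, shiftedChoose, if_pos (by omega), if_pos (by omega),
      if_pos h.le, show n + 1 - (k + 1) = n - (k + 1) + 1 by omega,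
      show n - k = n - (k + 1) + 1 by omega, add_comm (polyChoose _ (n - (k + 1))),
      ← polyChoose_pascal]
    congr 1
    push_cast
    ring
  · rw [shiftedChoose_of_lt (Nat.lt_succ_self k)]
    simp [shiftedChoose, polyChoose_zero]
  · rw [shiftedChoose_of_lt h, shiftedChoose_of_lt (by omega), shiftedChoose_of_lt (by omega),
      add_zero]

/-- Coefficient form of multiplication by (t/(1-t))^j; the induction works because `geomCoeff` and
`shiftedChoose` obey the same Pascal rule. -/
lemma shiftedChoose_add (n j k : ℕ) :
    shiftedChoose n (j + k) =
      ∑ x ∈ antidiagonal n, geomCoeff j x.1 • shiftedChoose x.2 k := by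
  induction n generalizing j with
  | zero =>
    rw [Nat.antidiagonal_zero, sum_singleton]
    cases j with
    | zero => simp [geomCoeff]
    | succ j => rw [geomCoeff_succ_zero, zero_smul, shiftedChoose_of_lt (by omega)]
  | succ n ih =>
    rw [Nat.sum_antidiagonal_succ]
    cases j with
    | zero => simp [geomCoeff]
    | succ j =>
      simp only [geomCoeff_pascal, geomCoeff_succ_zero, add_smul, sum_add_distrib, zero_smul,
        zero_add]
      rw [← ih, ← ih, show j + 1 + k = (j + k) + 1 by omega, shiftedChoose_pascal]

/-- This is exp(X_0 ∑ t^k / k) = (1-t)^(-X_0). Newton's identity makes n h_n equal to X_0 (h_0 + ...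
+ h_{n-1}), hence (n+1) h_{n+1} = (X_0 + n) h_n. -/
lemma cycleSum_const_X_zero (n : ℕ) :
    cycleSum (fun _ => X 0) n = polyChoose (X 0 + (n : Poly) - 1) n := by
  have hrec : ∀ n : ℕ, (n : ℚ) • cycleSum (fun _ => X 0) n =
      X 0 * ∑ i ∈ range n, cycleSum (fun _ => X 0) i := by
    intro n
    rw [natCast_smul_cycleSum, ← mul_sum]
    congr 1
    rw [← sum_range_reflect]
    refine sum_nbij' (fun k => k - 1) (fun k => k + 1) ?_ ?_ ?_ ?_ ?_ <;>
      intro k hk <;> simp only [mem_Icc, mem_range] at hk ⊢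
    · omega
    · omega
    · omega
    · omega
    · congr 1
      omega
  induction n with
  | zero => rw [cycleSum_zero, polyChoose_zero]
  | succ n ih =>
    have h0 : ((n + 1 : ℕ) : ℚ) ≠ 0 := by positivity
    refine smul_right_injective _ h0 ?_
    dsimp only
    rw [succ_smul_polyChoose, hrec, sum_range_succ, mul_add, ← hrec, ← ih, add_mul, add_comm,
      ← MvPolynomial.C_mul', map_natCast]

end PolyChoose


/-! ### Comparing coefficients of u^p v^q by the Euler derivation -/

section Series

/-- The exponent of the monomial `u ^ p v ^ q`. -/
def expo (p q : ℕ) : Fin 2 →₀ ℕ := Finsupp.equivFunOnFinite.symm ![p, q]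

lemma coeff_series (c : ℕ → ℕ → Poly) (d : Fin 2 →₀ ℕ) :
    MvPowerSeries.coeff d (series c) = c (d 0) (d 1) := rfl

lemma coeff_expo_mul (p q : ℕ) (f g : Series) :
    MvPowerSeries.coeff (expo p q) (f * g) =
      ∑ x ∈ antidiagonal p, ∑ z ∈ antidiagonal q,
        MvPowerSeries.coeff (expo x.1 z.1) f * MvPowerSeries.coeff (expo x.2 z.2) g := by
  rw [MvPowerSeries.coeff_mul, ← sum_product']
  refine sum_nbij' (fun e => ((e.1 0, e.2 0), (e.1 1, e.2 1)))
    (fun w => (expo w.1.1 w.2.1, expo w.1.2 w.2.2)) ?_ ?_ ?_ ?_ ?_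
  · intro e he
    rw [HasAntidiagonal.mem_antidiagonal] at he
    have h0 := DFunLike.congr_fun he 0
    have h1 := DFunLike.congr_fun he 1
    simpa [expo] using ⟨h0, h1⟩
  · intro w hw
    simp only [mem_product, HasAntidiagonal.mem_antidiagonal] at hw ⊢
    ext i
    fin_cases i
    · simpa [expo] using hw.1
    · simpa [expo] using hw.2
  · intro e _
    ext i <;> fin_cases i <;> rfl
  · intro w _
    rfl
  · intro e _
    congr 2
    · congr 1
      ext i; fin_cases i <;> rfl
    · congr 1
      ext i; fin_cases i <;> rfl

/-- The Euler derivation `u ∂/∂u + v ∂/∂v`. -/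
def euler : Derivation ℚ Series Series :=
  Derivation.mk'
    { toFun := fun f d => ((d 0 + d 1 : ℕ) : ℚ) • MvPowerSeries.coeff d f
      map_add' := fun f g => by
        funext d
        rw [map_add, smul_add]
        rfl
      map_smul' := fun c f => by
        funext d
        exact smul_comm _ c _ }
    (fun f g => by
      ext1 d
      rw [map_add, smul_eq_mul, smul_eq_mul, mul_comm g, MvPowerSeries.coeff_mul,
        MvPowerSeries.coeff_mul, ← sum_add_distrib]
      change ((d 0 + d 1 : ℕ) : ℚ) • MvPowerSeries.coeff d (f * g) = _
      rw [MvPowerSeries.coeff_mul, smul_sum]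
      refine sum_congr rfl fun e he => ?_
      rw [HasAntidiagonal.mem_antidiagonal] at he
      change _ = MvPowerSeries.coeff e.1 f *
          (((e.2 0 + e.2 1 : ℕ) : ℚ) • MvPowerSeries.coeff e.2 g) +
        (((e.1 0 + e.1 1 : ℕ) : ℚ) • MvPowerSeries.coeff e.1 f) * MvPowerSeries.coeff e.2 g
      rw [mul_smul_comm, smul_mul_assoc, ← add_smul, ← he]
      congr 1
      simp only [Finsupp.add_apply]
      push_cast
      ring)

lemma coeff_euler (p q : ℕ) (f : Series) :
    MvPowerSeries.coeff (expo p q) (euler f) =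
      ((p + q : ℕ) : ℚ) • MvPowerSeries.coeff (expo p q) f := rfl

lemma coeff_S (k p q : ℕ) :
    MvPowerSeries.coeff (expo p q) (S k) =
      (((k + p - 1).choose p : ℚ) * ((k + q - 1).choose q : ℚ)) • X (p + q) := by
  have h : ∀ r : ℕ, (k.ascFactorial r : ℚ) / (r.factorial : ℚ) = ((k + r - 1).choose r : ℚ) := by
    intro r
    rw [Nat.ascFactorial_eq_factorial_mul_choose']
    have := r.factorial_ne_zero
    push_cast
    field_simp
  rw [S, coeff_series, h, h]
  rfl

lemma geomCoeff_eq_zero_of_lt {j k : ℕ} (h : k < j) : geomCoeff j k = 0 := by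
  rw [geomCoeff, if_neg (by omega)]
  split_ifs with hk
  · rfl
  · rw [Nat.choose_eq_zero_of_lt (by omega), Nat.cast_zero]

lemma binom₃_zero_left (p k : ℕ) : binom₃ 0 p k = 0 := by simp [binom₃]

lemma binom₃_zero_right (m p : ℕ) : binom₃ m p 0 = 0 := by simp [binom₃]

lemma binom₃_eq_zero_of_lt {m p k : ℕ} (hp : p ≤ m) (hk : m < k) : binom₃ m p k = 0 := by
  rcases eq_or_ne m 0 with rfl | hm
  · exact binom₃_zero_left p k
  rw [binom₃, sum_eq_zero, mul_zero]
  intro r _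
  by_cases h1 : r ≤ p
  · by_cases h2 : r ≤ m - p
    · rw [Nat.choose_eq_zero_of_lt (n := m - r - 1) (by omega), Nat.cast_zero, mul_zero]
    · rw [Nat.choose_eq_zero_of_lt (n := m - p) (by omega), Nat.cast_zero, mul_zero, zero_mul]
  · rw [Nat.choose_eq_zero_of_lt (n := p) (by omega), Nat.cast_zero, zero_mul, zero_mul]

/-- Lets the range of j depend on n only, as the later exchange of sums needs: terms with j > k
vanish. -/
lemma sum_binom₃_mul_geomCoeff_of_le {n k : ℕ} (p q : ℕ) (hk : 1 ≤ k) (hkn : k ≤ n) :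
    ∑ j ∈ range (n + 1), binom₃ (p + q) p j * geomCoeff j k =
      ((p + q : ℕ) : ℚ) / k * (((k + p - 1).choose p : ℚ) * ((k + q - 1).choose q : ℚ)) := by
  rw [← sum_subset (range_subset_range.2 (Nat.succ_le_succ hkn))]
  · rcases Nat.eq_zero_or_pos (p + q) with h | h
    · simp [h, binom₃_zero_left]
    · exact sum_binom₃_mul_geomCoeff k p q hk h
  · intro j _ hj
    rw [geomCoeff_eq_zero_of_lt (by simpa using hj), mul_zero]

lemma natCast_smul_coeff_cycleSum_S (n p q : ℕ) :
    ((p + q : ℕ) : ℚ) • MvPowerSeries.coeff (expo p q) (cycleSum S n) =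
      ∑ x ∈ antidiagonal p, ∑ z ∈ antidiagonal q, ∑ k ∈ Icc 1 n,
        ((∑ j ∈ range (n + 1), binom₃ (x.1 + z.1) x.1 j * geomCoeff j k) • X (x.1 + z.1)) *
          MvPowerSeries.coeff (expo x.2 z.2) (cycleSum S (n - k)) := by
  rw [← coeff_euler, derivation_cycleSum, map_sum]
  have h : ∀ k ∈ Icc 1 n, MvPowerSeries.coeff (expo p q)
      ((1 / k : ℚ) • (euler (S k) * cycleSum S (n - k))) =
      ∑ x ∈ antidiagonal p, ∑ z ∈ antidiagonal q,
        ((∑ j ∈ range (n + 1), binom₃ (x.1 + z.1) x.1 j * geomCoeff j k) • X (x.1 + z.1)) *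
          MvPowerSeries.coeff (expo x.2 z.2) (cycleSum S (n - k)) := by
    intro k hk
    obtain ⟨h1, h2⟩ := mem_Icc.1 hk
    change (1 / k : ℚ) • MvPowerSeries.coeff (expo p q) (euler (S k) * cycleSum S (n - k)) = _
    rw [coeff_expo_mul, smul_sum]
    refine sum_congr rfl fun x _ => ?_
    rw [smul_sum]
    refine sum_congr rfl fun z _ => ?_
    rw [coeff_euler, coeff_S, sum_binom₃_mul_geomCoeff_of_le _ _ h1 h2, ← smul_mul_assoc,
      smul_smul, smul_smul]
    congr 2
    ring
  rw [sum_congr rfl h, sum_comm]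
  exact sum_congr rfl fun x _ => sum_comm

/-- Explains the bound min(n, p+q) in the theorem; follows by induction from the recurrence. -/
lemma P_eq_zero_of_lt_right (n p k : ℕ) (h : n < k) : P n p k = 0 := by
  induction n using Nat.strong_induction_on generalizing p k with
  | _ n ih =>
    rcases eq_or_ne n 0 with rfl | hn
    · rw [← coeff_coeff_cycleSum_binomSeries, cycleSum_zero, PowerSeries.coeff_one]
      split_ifs
      · rw [PowerSeries.coeff_one, if_neg h.ne']
      · rw [map_zero]
    · have h0 : (n : ℚ) • P n p k = 0 := by
        rw [natCast_smul_P]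
        refine sum_eq_zero fun m hm => sum_eq_zero fun x _ => sum_eq_zero fun y hy => ?_
        rw [mem_Icc] at hm
        rw [HasAntidiagonal.mem_antidiagonal] at hy
        split_ifs with hx
        · by_cases hym : y.1 ≤ m
          · rw [ih (n - m) (by omega) _ _ (by omega), mul_zero]
          · rw [binom₃_eq_zero_of_lt hx.1 (not_le.1 hym), zero_smul, zero_mul]
        · rw [zero_mul]
      exact (smul_eq_zero.1 h0).resolve_left (by exact_mod_cast hn)

/-- The coefficient of `u ^ p v ^ q` on the right-hand side of the identity. -/
def rightCoeff (n p q : ℕ) : Poly :=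
  ∑ k ∈ range (n + 1), shiftedChoose n k * P (p + q) p k

lemma rightCoeff_eq_sum_range {n M : ℕ} (h : n ≤ M) (p q : ℕ) :
    rightCoeff n p q = ∑ k ∈ range (M + 1), shiftedChoose n k * P (p + q) p k := by
  refine sum_subset (range_subset_range.2 (Nat.succ_le_succ h)) fun k _ hk => ?_
  rw [shiftedChoose_of_lt (by simpa using hk), zero_mul]

lemma rightCoeff_eq_sum_min (n p q : ℕ) :
    rightCoeff n p q = ∑ k ∈ range (min n (p + q) + 1),
      polyChoose (X 0 + (n : Poly) - 1) (n - k) * P (p + q) p k := by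
  have h : min n (p + q) ≤ n := min_le_left _ _
  rw [rightCoeff, ← sum_subset (range_subset_range.2 (Nat.succ_le_succ h))]
  · refine sum_congr rfl fun k hk => ?_
    rw [mem_range] at hk
    rw [shiftedChoose, if_pos (by omega)]
  · intro k hk hk'
    rw [mem_range] at hk hk'
    rw [P_eq_zero_of_lt_right _ _ _ (by omega), mul_zero]

/-- For j ≠ 0 the series (t/(1-t))^j has no constant term, so i = 0 drops out. -/
lemma shiftedChoose_add_eq_sum_range (n j k : ℕ) (hj : j ≠ 0) :
    shiftedChoose n (j + k) =
      ∑ i ∈ Icc 1 n, geomCoeff j i • shiftedChoose (n - i) k := by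
  rw [shiftedChoose_add, Nat.sum_antidiagonal_eq_sum_range_succ_mk]
  symm
  refine sum_subset (fun i hi => ?_) fun i hi hi' => ?_
  · simp only [mem_Icc, mem_range] at hi ⊢
    omega
  · simp only [mem_Icc, mem_range] at hi hi'
    obtain ⟨j, rfl⟩ := Nat.exists_eq_succ_of_ne_zero hj
    rw [show i = 0 by omega, Nat.succ_eq_add_one, geomCoeff_succ_zero, zero_smul]

/-- The recurrence for P splits k as j + i, and `shiftedChoose n (j + i)` splits by convolution;
regrouping yields the recurrence of the left side. -/
lemma natCast_smul_rightCoeff (n p q : ℕ) :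
    ((p + q : ℕ) : ℚ) • rightCoeff n p q =
      ∑ x ∈ antidiagonal p, ∑ z ∈ antidiagonal q, ∑ k ∈ Icc 1 n,
        ((∑ j ∈ range (n + 1), binom₃ (x.1 + z.1) x.1 j * geomCoeff j k) • X (x.1 + z.1)) *
          rightCoeff (n - k) x.2 z.2 := by
  have h1 : ((p + q : ℕ) : ℚ) • rightCoeff n p q =
      ∑ x ∈ antidiagonal p, ∑ z ∈ antidiagonal q, ∑ k ∈ range (n + 1), ∑ y ∈ antidiagonal k,
        shiftedChoose n (y.1 + y.2) *
          ((binom₃ (x.1 + z.1) x.1 y.1 • X (x.1 + z.1)) * P (x.2 + z.2) x.2 y.2) := by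
    rw [rightCoeff, smul_sum, sum_congr rfl fun x _ => sum_comm, sum_comm]
    refine sum_congr rfl fun k _ => ?_
    rw [← mul_smul_comm, natCast_smul_P_add, mul_sum]
    refine sum_congr rfl fun x _ => ?_
    rw [mul_sum]
    refine sum_congr rfl fun z _ => ?_
    rw [mul_sum]
    refine sum_congr rfl fun y hy => ?_
    rw [HasAntidiagonal.mem_antidiagonal.1 hy]
  rw [h1]
  refine sum_congr rfl fun x _ => sum_congr rfl fun z _ => ?_
  generalize hb : (fun j => binom₃ (x.1 + z.1) x.1 j) = b
  have hb0 : b 0 = 0 := by rw [← hb]; exact binom₃_zero_right _ _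
  have hb' : ∀ j, binom₃ (x.1 + z.1) x.1 j = b j := fun j => congrFun hb j
  simp only [hb']
  generalize X (x.1 + z.1) = Y
  have h2 : ∀ k ∈ Icc 1 n, ((∑ j ∈ range (n + 1), b j * geomCoeff j k) • Y) *
        rightCoeff (n - k) x.2 z.2 =
      ∑ j ∈ range (n + 1), ∑ i ∈ range (n + 1),
        (geomCoeff j k • shiftedChoose (n - k) i) * ((b j • Y) * P (x.2 + z.2) x.2 i) := by
    intro k _
    rw [rightCoeff_eq_sum_range (Nat.sub_le n k), sum_smul, sum_mul_sum]
    refine sum_congr rfl fun j _ => sum_congr rfl fun i _ => ?_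
    simp only [← MvPolynomial.C_mul', map_mul]
    ring
  rw [sum_congr rfl h2, sum_comm]
  -- The term j = 0 vanishes with b 0; for j + i > n `shiftedChoose` is zero, leaving the triangle j
  -- + i ≤ n to be summed along diagonals.
  have h3 : ∀ j ∈ range (n + 1), (∑ k ∈ Icc 1 n, ∑ i ∈ range (n + 1),
        (geomCoeff j k • shiftedChoose (n - k) i) * ((b j • Y) * P (x.2 + z.2) x.2 i)) =
      ∑ i ∈ range (n + 1 - j), shiftedChoose n (j + i) * ((b j • Y) * P (x.2 + z.2) x.2 i) := by
    intro j _
    rw [sum_comm]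
    symm
    rcases eq_or_ne j 0 with rfl | hj
    · simp [hb0]
    · simp_rw [← sum_mul, ← shiftedChoose_add_eq_sum_range n j _ hj]
      refine sum_subset (range_subset_range.2 (Nat.sub_le _ _)) fun i _ hi => ?_
      rw [mem_range] at hi
      rw [shiftedChoose_of_lt (by omega), zero_mul]
  rw [sum_congr rfl h3, ← sum_range_diag_flip (n + 1) fun j i =>
    shiftedChoose n (j + i) * ((b j • Y) * P (x.2 + z.2) x.2 i)]
  exact sum_congr rfl fun k _ => Nat.sum_antidiagonal_eq_sum_range_succ (fun j i =>
    shiftedChoose n (j + i) * ((b j • Y) * P (x.2 + z.2) x.2 i)) k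

lemma coeff_zero_cycleSum_S (n : ℕ) :
    MvPowerSeries.coeff (expo 0 0) (cycleSum S n) = rightCoeff n 0 0 := by
  have h0 : expo 0 0 = 0 := by
    ext i
    fin_cases i <;> rfl
  let f : Series →ₐ[ℚ] Poly := (MvPowerSeries.constantCoeff : Series →+* Poly).toRatAlgHom
  have hf : ∀ k, f (S k) = X 0 := by
    intro k
    change MvPowerSeries.coeff 0 (S k) = X 0
    rw [← h0, coeff_S]
    simp
  have h1 : MvPowerSeries.coeff (expo 0 0) (cycleSum S n) = f (cycleSum S n) := by
    rw [h0]
    rfl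
  rw [h1, map_cycleSum, funext hf, cycleSum_const_X_zero, rightCoeff_eq_sum_min]
  simp [P]

lemma coeff_cycleSum_S (n p q : ℕ) :
    MvPowerSeries.coeff (expo p q) (cycleSum S n) = rightCoeff n p q := by
  induction hN : p + q using Nat.strong_induction_on generalizing n p q with
  | _ N ih =>
    subst hN
    rcases Nat.eq_zero_or_pos (p + q) with h | h
    · obtain ⟨rfl, rfl⟩ := Nat.add_eq_zero_iff.1 h
      exact coeff_zero_cycleSum_S n
    · have h0 : ((p + q : ℕ) : ℚ) ≠ 0 := by exact_mod_cast h.ne'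
      refine smul_right_injective _ h0 ?_
      dsimp only
      rw [natCast_smul_coeff_cycleSum_S, natCast_smul_rightCoeff]
      refine sum_congr rfl fun x hx => sum_congr rfl fun z hz => sum_congr rfl fun k _ => ?_
      rw [HasAntidiagonal.mem_antidiagonal] at hx hz
      -- If x.1 + z.1 = 0 the remaining degree has not dropped, but `binom₃ 0` is zero.
      rcases Nat.eq_zero_or_pos (x.1 + z.1) with h1 | h1
      · simp [h1, binom₃_zero_left]
      · rw [ih _ (by omega) _ _ _ rfl]

end Series

end PartitionIdentity

end

theorem theorem3p1 (n : ℕ) (hn : 1 ≤ n) :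
    (∑ μ : n.Partition,
        (1 / PartitionIdentity.zCoeff μ) •
          ∏ k ∈ Finset.Icc 1 n, PartitionIdentity.S k ^ PartitionIdentity.mult μ k) =
      PartitionIdentity.series fun p q =>
        ∑ k ∈ Finset.range (min n (p + q) + 1),
          PartitionIdentity.polyChoose (PartitionIdentity.X 0 + (n : PartitionIdentity.Poly) - 1)
              (n - k) *
            PartitionIdentity.P (p + q) p k := by
  have h : (∑ μ : n.Partition,
        (1 / PartitionIdentity.zCoeff μ) •
          ∏ k ∈ Finset.Icc 1 n, PartitionIdentity.S k ^ PartitionIdentity.mult μ k) =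
      PartitionIdentity.cycleSum PartitionIdentity.S n :=
    Finset.sum_congr rfl fun μ _ => by rw [← PartitionIdentity.prod_map_parts]
  rw [h]
  ext1 d
  have hd : d = PartitionIdentity.expo (d 0) (d 1) := by
    ext i
    fin_cases i <;> rfl
  rw [PartitionIdentity.coeff_series, ← PartitionIdentity.rightCoeff_eq_sum_min,
    ← PartitionIdentity.coeff_cycleSum_S, ← hd]
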